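/- Let $A(t,\xi)$ ($t\ge0$, $\xi\in\mathbb R^n$) be $d\times d$ complex matrices and write $\mathrm D=-\mathrm i\partial$. For $N>0$ let $\mathcal Z_{\rm hyp}(N)=\{(t,\xi): t\ge 0,\ (1+t)|\xi|\ge N\}$ and, for $\xi\neq0$, $t_\xi=\max\{N/|\xi|-1,0\}$. Let $\mathcal S\{m_1,m_2\}$ be the set of functions $a$ which, for some $N>0$, are $C^\infty$ on $\mathcal Z_{\rm hyp}(N)$ with $$|\mathrm D_t^k\mathrm D_\xi^\alpha a(t,\xi)|\le C_{k,\alpha}|\xi|^{m_1-|\alpha|}(1+t)^{-m_2-k}$$ there for all $k,\alpha$; matrix symbols are understood entrywise. Assume: **(A1)** There is $A_{\rm hom}\in\mathcal S\{1,0\}\otimes\mathbb C^{d\times d}$ with $A_{\rm hom}(t,\rho\xi)=\rho A_{\rm hom}(t,\xi)$ for $\rho>0$, $t\ge 0$, $\xi\ne0$, such that $A-A_{\rm hom}\in\mathcal S\{0,1\}\otimes\mathbb C^{d\times d}$, and the eigenvalues $\lambda_1,\dots,\lambda_d$ of $A_{\rm hom}(t,\xi)$ are real and satisfy $|\lambda_i(t,\xi)-\lambda_j(t,\xi)|\ge\delta|\xi|$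 for $i\ne j$, all $t\ge0$ and $\xi\neq0$, with some $\delta>0$. **(A2)** There are a zone constant $N>0$, an $M\in\mathcal S\{0,0\}\otimes\mathbb C^{d\times d}$ that is invertible on $\mathcal Z_{\rm hyp}(N)$ with $M^{-1}\in\mathcal S\{0,0\}\otimes\mathbb C^{d\times d}$ and $M^{-1}A_{\rm hom}M$ diagonal on $\mathcal Z_{\rm hyp}(N)$, and a diagonal $F_0$ with $$F_0\equiv\operatorname{diag}\big(M^{-1}(A-A_{\rm hom})M+(\mathrm D_tM^{-1})M\big)\mod \mathcal S\{-1,2\}\otimes\mathbb C^{d\times d},$$ such that for the given constants $\kappa_\pm\in\mathbb R$ and suitable $C_\pm\in\mathbb R$ each diagonal entry $f$ of $F_0$ satisfies, for all $\xi\ne0$ and $t\ge s\ge t_\xi$ (formed with this $N$), $$\kappa_+\log\tfrac{1+t}{1+s}+C_+\le\operatorname{Im}\int_s^t f(\tau,\xi)\,\mathrm d\tau\le\kappa_-\log\tfrac{1+t}{1+s}+C_-.$$ Then there is $N_0>0$ such that for every zone constant $N\ge N_0$ there is a constant $C>0$ with the following property: for every $\xi\ne0$ and with $t_\xi$ formed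 with $N$, the fundamental solution $\mathcal E(t,t_\xi,\xi)$, i.e. the solution on $[t_\xi,\infty)$ of $\mathrm D_t\mathcal E(t,t_\xi,\xi)=A(t,\xi)\mathcal E(t,t_\xi,\xi)$, $\mathcal E(t_\xi,t_\xi,\xi)=\mathrm I$, exists, and $$\|\mathcal E(t,t_\xi,\xi)\|\le C\Big(\frac{1+t}{1+t_\xi}\Big)^{-\kappa_+}\qquad\text{for all } t\ge t_\xi,$$ where $\|\cdot\|$ is the Euclidean operator norm. -/

import Mathlib

open scoped ContDiff

noncomputable section

namespace HypSys

/-- Points `(t, ξ)` of the extended phase space; only times `t ≥ 0` are ever used. -/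
abbrev Phase (n : ℕ) : Type := ℝ × EuclideanSpace ℝ (Fin n)

/-- The hyperbolic zone `{(t, ξ) : t ≥ 0, (1 + t)|ξ| ≥ N}`. -/
def Zhyp (n : ℕ) (N : ℝ) : Set (Phase n) :=
  {z | 0 ≤ z.1 ∧ N ≤ (1 + z.1) * ‖z.2‖}

/-- The zone boundary `t_ξ = max (N / |ξ| - 1) 0`, used for `ξ ≠ 0` only. -/
def tBdry {n : ℕ} (N : ℝ) (ξ : EuclideanSpace ℝ (Fin n)) : ℝ :=
  max (N / ‖ξ‖ - 1) 0

/-- The mixed partial derivative `∂_t^k ∂_{ξ_{e 0}} ⋯ ∂_{ξ_{e (l-1)}} a` within the hyperbolic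
zone (one-sided on its boundary). The multi-indices of length `l` correspond to the sequences
`e : Fin l → Fin n` of coordinate directions, up to order. -/
def mixedDeriv {n : ℕ} (N : ℝ) (k : ℕ) {l : ℕ} (e : Fin l → Fin n) (a : Phase n → ℂ)
    (z : Phase n) : ℂ :=
  iteratedFDerivWithin ℝ (k + l) a (Zhyp n N) z
    (Fin.append (fun _ : Fin k => ((1, 0) : Phase n))
      (fun r : Fin l => ((0, EuclideanSpace.single (e r) 1) : Phase n)))

/-- `a` is smooth on the hyperbolic zone with zone constant `N` and satisfies there
`|D_t^k D_ξ^α a(t, ξ)| ≤ C_{k,α} |ξ|^(m₁ - |α|) (1 / (1 + t))^(m₂ + k)`. -/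
def IsSymbolOn {n : ℕ} (N m₁ m₂ : ℝ) (a : Phase n → ℂ) : Prop :=
  ContDiffOn ℝ ∞ a (Zhyp n N) ∧
    ∀ (k l : ℕ) (e : Fin l → Fin n), ∃ C : ℝ, ∀ z ∈ Zhyp n N,
      ‖mixedDeriv N k e a z‖ ≤ C * ‖z.2‖ ^ (m₁ - l) * (1 / (1 + z.1)) ^ (m₂ + k)

/-- The symbol class `S{m₁, m₂}`. -/
def IsSymbol {n : ℕ} (m₁ m₂ : ℝ) (a : Phase n → ℂ) : Prop :=
  ∃ N : ℝ, 0 < N ∧ IsSymbolOn N m₁ m₂ a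

/-- The matrix-valued symbol class `S{m₁, m₂} ⊗ ℂ^{d × d}`. -/
def IsMatSymbol {n d : ℕ} (m₁ m₂ : ℝ) (B : Phase n → Matrix (Fin d) (Fin d) ℂ) : Prop :=
  ∀ i j, IsSymbol m₁ m₂ (fun z => B z i j)

/-- Entrywise `D_t B = -i ∂_t B` (one-sided on the boundary of the hyperbolic zone). -/
def matDt {n d : ℕ} (N : ℝ) (B : Phase n → Matrix (Fin d) (Fin d) ℂ) (z : Phase n) :
    Matrix (Fin d) (Fin d) ℂ :=
  Matrix.of fun i j =>
    -Complex.I * fderivWithin ℝ (fun w => B w i j) (Zhyp n N) z ((1, 0) : Phase n)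

/-- Uniform strict hyperbolicity of `D_t U = A(t, D_x) U` with hyperbolic principal symbol
`Ahom`: a positively homogeneous `Ahom ∈ S{1, 0}` with `A - Ahom ∈ S{0, 1}`, whose eigenvalues
are real and uniformly separated. -/
structure AssumptionA1 {n d : ℕ} (A Ahom : Phase n → Matrix (Fin d) (Fin d) ℂ) : Prop where
  homogeneous : ∀ t : ℝ, 0 ≤ t → ∀ ξ : EuclideanSpace ℝ (Fin n), ξ ≠ 0 → ∀ ρ : ℝ, 0 < ρ →
    Ahom (t, ρ • ξ) = (ρ : ℂ) • Ahom (t, ξ)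
  symbol_hom : IsMatSymbol 1 0 Ahom
  symbol_sub : IsMatSymbol 0 1 (fun z => A z - Ahom z)
  eigenvalues : ∃ (ev : Fin d → Phase n → ℝ) (δ : ℝ), 0 < δ ∧
    ∀ t : ℝ, 0 ≤ t → ∀ ξ : EuclideanSpace ℝ (Fin n), ξ ≠ 0 →
      (Ahom (t, ξ)).charpoly =
          ∏ j, (Polynomial.X - Polynomial.C ((ev j (t, ξ) : ℝ) : ℂ)) ∧
        ∀ i j, i ≠ j → δ * ‖ξ‖ ≤ |ev i (t, ξ) - ev j (t, ξ)|

/-- On the hyperbolic zone with constant `N`, the matrix `M` is invertible and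
`M⁻¹ Ahom M` is diagonal; moreover `M` and `M⁻¹` belong to `S{0, 0} ⊗ ℂ^{d × d}`. -/
structure IsDiagonaliser {n d : ℕ} (N : ℝ) (Ahom M : Phase n → Matrix (Fin d) (Fin d) ℂ) :
    Prop where
  invertible : ∀ z ∈ Zhyp n N, IsUnit (M z).det
  diagonal : ∀ z ∈ Zhyp n N, ((M z)⁻¹ * Ahom z * M z).IsDiag
  symbol : IsMatSymbol 0 0 M
  symbol_inv : IsMatSymbol 0 0 (fun z => (M z)⁻¹)

/-- `R₀ = M⁻¹ (A - Ahom) M + (D_t M⁻¹) M`. -/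
def subprincipal {n d : ℕ} (N : ℝ) (A Ahom M : Phase n → Matrix (Fin d) (Fin d) ℂ)
    (z : Phase n) : Matrix (Fin d) (Fin d) ℂ :=
  (M z)⁻¹ * (A z - Ahom z) * M z + matDt N (fun w => (M w)⁻¹) z * M z

/-- For some zone constant `N`, some diagonaliser `M` of `Ahom` and some representative
`F₀ = diag (F₀ 1, …, F₀ d)` of `diag R₀` modulo `S{-1, 2}`, the imaginary part of
`∫_s^t F₀(τ, ξ) dτ` lies between `κ₊ log ((1 + t) / (1 + s)) + C₊` and
`κ₋ log ((1 + t) / (1 + s)) + C₋` for all `t ≥ s ≥ t_ξ` and `ξ ≠ 0`. -/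
def AssumptionA2 {n d : ℕ} (A Ahom : Phase n → Matrix (Fin d) (Fin d) ℂ) (κp κm : ℝ) : Prop :=
  ∃ (N : ℝ) (M : Phase n → Matrix (Fin d) (Fin d) ℂ) (F₀ : Fin d → Phase n → ℂ) (Cp Cm : ℝ),
    0 < N ∧ IsDiagonaliser N Ahom M ∧
    (∀ j, IsSymbol (-1) 2 (fun z => F₀ j z - subprincipal N A Ahom M z j j)) ∧
    ∀ (j : Fin d) (ξ : EuclideanSpace ℝ (Fin n)), ξ ≠ 0 →
      ∀ s t : ℝ, tBdry N ξ ≤ s → s ≤ t →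
        κp * Real.log ((1 + t) / (1 + s)) + Cp ≤ (∫ τ in s..t, F₀ j (τ, ξ)).im ∧
        (∫ τ in s..t, F₀ j (τ, ξ)).im ≤ κm * Real.log ((1 + t) / (1 + s)) + Cm

/-- `E = 𝓔(·, s, ξ)` on `[s, ∞)`: the matrix solution of `D_t E = A(t, ξ) E`, that is
`∂_t E = i A(t, ξ) E`, with `E(s) = I`. -/
structure IsFundamentalSolution {n d : ℕ} (A : Phase n → Matrix (Fin d) (Fin d) ℂ)
    (ξ : EuclideanSpace ℝ (Fin n)) (s : ℝ) (E : ℝ → Matrix (Fin d) (Fin d) ℂ) : Prop where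
  initial : E s = 1
  equation : ∀ t : ℝ, s ≤ t → ∀ i j,
    HasDerivWithinAt (fun τ => E τ i j) (Complex.I * (A (t, ξ) * E t) i j) (Set.Ici s) t

/-- The operator norm of a matrix on Euclidean `ℂ^d`. -/
def opNorm {d : ℕ} (B : Matrix (Fin d) (Fin d) ℂ) : ℝ :=
  ‖Matrix.toEuclideanCLM (𝕜 := ℂ) B‖

end HypSys

end

/-! The system is diagonalised twice. With `V = M⁻¹E` it becomes `D_t V = (𝒟 + R)V`, where `𝒟` is
real, diagonal, with entries `δ|ξ|`-separated, and `R` has order `{0, 1}`. Put `K i j = R i j / (𝒟 j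
- 𝒟 i)` off the diagonal and zero on it. Then `K` has order `{-1, 1}`, its commutator with `𝒟`
cancels the off-diagonal part of `R`, and `W = (1 - K)V` solves `D_t W = (𝒟 + F₀)W + QV` with `Q` of
order `{-1, 2}`.

The real matrix `𝒟` only produces phases. By the lower bound on `Im ∫ F₀`, the diagonal part
propagates with the factor `e^(-c) ((1 + t)/(1 + s))^(-κ₊)`. The remainder is harmless, since `|ξ|⁻¹
(1 + τ)⁻²` integrates over `[t_ξ, ∞)` to `1/(|ξ|(1 + t_ξ)) ≤ 1/N`. Likewise `K = O(1/N)`, so a large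
`N` makes `1 - K` invertible and lets the remainder be absorbed.

Only bounds uniform in `ξ` matter, so derivatives in `ξ` are discarded (`TimeSymbol`). The analytic
core is `norm_le_of_diagonal_dominated_system`; `entry_bound_of_diagonalised_system` combines it
with the two algebraic steps. -/

/-! ### Global solvability of linear equations -/

/-- Picard iteration in an exponentially weighted norm: for `x = e^G y` with `G' = 2‖L‖`, the
integral operator contracts by `1/2` on bounded continuous `y`, so one fixed point serves the whole
half-line. -/
theorem exists_hasDerivWithinAt_linear {X : Type*} [NormedAddCommGroup X] [NormedSpace ℝ X]
    [CompleteSpace X] (L : ℝ → X →L[ℝ] X) (hL : Continuous L) (s : ℝ) (x₀ : X) :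
    ∃ x : ℝ → X, x s = x₀ ∧
      ∀ t, s ≤ t → HasDerivWithinAt x (L t (x t)) (Set.Ici s) t := by
  obtain ⟨G, hG0, hG⟩ : ∃ G : ℝ → ℝ, G s = 0 ∧ ∀ t, HasDerivAt G (2 * ‖L t‖) t :=
    ⟨fun t => ∫ τ in s..t, 2 * ‖L τ‖, by simp, fun t =>
      (continuous_const.mul hL.norm).integral_hasStrictDerivAt s t |>.hasDerivAt⟩
  have hGc : Continuous G := continuous_iff_continuousAt.2 fun t => (hG t).continuousAt
  have hexp : ∀ t, HasDerivAt (fun τ => Real.exp (G τ)) (Real.exp (G t) * (2 * ‖L t‖)) t :=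
    fun t => (hG t).exp
  have hGe : Continuous fun τ => Real.exp (G τ) := Real.continuous_exp.comp hGc
  have hcont : ∀ z : ℝ → X, Continuous z → Continuous fun τ => Real.exp (G τ) • L τ (z τ) :=
    fun z hz => hGe.smul (hL.clm_apply hz)
  have key : ∀ (z : ℝ → X) (c : ℝ), 0 ≤ c → Continuous z → (∀ τ, ‖z τ‖ ≤ c) → ∀ u, s ≤ u →
      ‖Real.exp (-G u) • ∫ τ in s..u, Real.exp (G τ) • L τ (z τ)‖ ≤ c / 2 := by
    intro z c hc hz hzc u hu
    have h1 : ‖∫ τ in s..u, Real.exp (G τ) • L τ (z τ)‖ ≤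
        ∫ τ in s..u, c / 2 * (Real.exp (G τ) * (2 * ‖L τ‖)) := by
      apply intervalIntegral.norm_integral_le_of_norm_le hu
      · filter_upwards with τ _
        rw [norm_smul, Real.norm_of_nonneg (Real.exp_pos _).le]
        have : ‖L τ (z τ)‖ ≤ ‖L τ‖ * c :=
          (L τ).le_of_opNorm_le_of_le le_rfl (hzc τ)
        nlinarith [Real.exp_pos (G τ)]
      · exact (continuous_const.mul (hGe.mul (continuous_const.mul hL.norm))).intervalIntegrable _ _
    -- The majorant is exact, `(e^G)' = 2‖L‖ e^G`; this is where the gain `1/2` comes from.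
    rw [intervalIntegral.integral_const_mul, intervalIntegral.integral_eq_sub_of_hasDerivAt
      (fun t _ => hexp t)
      ((hGe.mul (continuous_const.mul hL.norm)).intervalIntegrable _ _), hG0, Real.exp_zero] at h1
    rw [norm_smul, Real.norm_of_nonneg (Real.exp_pos _).le]
    calc _ ≤ Real.exp (-G u) * (c / 2 * (Real.exp (G u) - 1)) := by gcongr
      _ ≤ Real.exp (-G u) * (c / 2 * Real.exp (G u)) := by gcongr; linarith
      _ = c / 2 := by rw [Real.exp_neg]; field_simp
  have hGu : ∀ u, s ≤ u → 0 ≤ G u := by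
    intro u hu
    have : Monotone G := monotone_of_hasDerivAt_nonneg hG fun t => by positivity
    rw [← hG0]; exact this hu
  have hprim : ∀ z : ℝ → X, Continuous z → ∀ t, HasDerivAt
      (fun u => ∫ τ in s..u, Real.exp (G τ) • L τ (z τ)) (Real.exp (G t) • L t (z t)) t :=
    fun z hz t => ((hcont z hz).integral_hasStrictDerivAt s t).hasDerivAt
  have hprimc : ∀ z : ℝ → X, Continuous z → Continuous
      (fun u => ∫ τ in s..u, Real.exp (G τ) • L τ (z τ)) :=
    fun z hz => continuous_iff_continuousAt.2 fun t => (hprim z hz t).continuousAt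
  -- Freezing the time at `s` for `t < s` keeps the iteration in the bounded continuous functions on
  -- all of `ℝ`.
  let S : (ℝ → X) → ℝ → X := fun z t => Real.exp (-G (max s t)) •
    (x₀ + ∫ τ in s..(max s t), Real.exp (G τ) • L τ (z τ))
  have hS : ∀ z : BoundedContinuousFunction ℝ X, Continuous (S z) := by
    intro z
    have hm : Continuous fun t : ℝ => max s t := continuous_const.max continuous_id
    exact (Real.continuous_exp.comp (hGc.comp hm).neg).smul
      (continuous_const.add ((hprimc z z.continuous).comp hm))
  have hSb : ∀ (z : BoundedContinuousFunction ℝ X) (t : ℝ), ‖S z t‖ ≤ ‖x₀‖ + ‖z‖ / 2 := by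
    intro z t
    simp only [S, smul_add]
    refine (norm_add_le _ _).trans (add_le_add ?_
      (key z ‖z‖ (norm_nonneg _) z.continuous z.norm_coe_le_norm _ (le_max_left _ _)))
    rw [norm_smul, Real.norm_of_nonneg (Real.exp_pos _).le]
    refine mul_le_of_le_one_left (norm_nonneg _) (Real.exp_le_one_iff.2 ?_)
    linarith [hGu _ (le_max_left s t)]
  let T : BoundedContinuousFunction ℝ X → BoundedContinuousFunction ℝ X := fun z =>
    BoundedContinuousFunction.ofNormedAddCommGroup (S z) (hS z) _ (hSb z)
  have hT : ContractingWith (1 / 2) T := by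
    refine ⟨by norm_num, LipschitzWith.of_dist_le_mul fun y z => ?_⟩
    rw [BoundedContinuousFunction.dist_le (by positivity)]
    intro t
    have hyz := key (fun τ => y τ - z τ) (dist y z) dist_nonneg (y.continuous.sub z.continuous)
      (fun τ => by rw [← dist_eq_norm]; exact BoundedContinuousFunction.dist_coe_le_dist τ)
      (max s t) (le_max_left _ _)
    have : dist (T y t) (T z t) = ‖Real.exp (-G (max s t)) •
        ∫ τ in s..(max s t), Real.exp (G τ) • L τ (y τ - z τ)‖ := by
      rw [dist_eq_norm]
      simp only [T, S, BoundedContinuousFunction.coe_ofNormedAddCommGroup, map_sub, smul_sub]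
      rw [intervalIntegral.integral_sub ((hcont y y.continuous).intervalIntegrable _ _)
        ((hcont z z.continuous).intervalIntegrable _ _), ← smul_sub, add_sub_add_left_eq_sub,
        smul_sub]
    rw [this]
    refine hyz.trans (le_of_eq ?_)
    push_cast; ring
  obtain ⟨y, hy, -⟩ := hT.exists_fixedPoint 0 (edist_ne_top _ _)
  have hyS : ∀ t, s ≤ t →
      Real.exp (G t) • y t = x₀ + ∫ τ in s..t, Real.exp (G τ) • L τ (y τ) := by
    intro t ht
    have h1 : y t = S y t := congrArg (fun z : BoundedContinuousFunction ℝ X => z t) hy.symm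
    simp only [S, max_eq_right ht] at h1
    conv_lhs => rw [h1]
    rw [smul_smul, ← Real.exp_add, add_neg_cancel, Real.exp_zero, one_smul]
  refine ⟨fun t => Real.exp (G t) • y t, (hyS s le_rfl).trans (by simp), fun t ht => ?_⟩
  rw [map_smul]
  exact ((hprim y y.continuous t).hasDerivWithinAt.const_add x₀).congr
    (fun u hu => hyS u hu) (hyS t ht)

/-! ### Symbol calculus in the time variable -/

namespace HypSys

/-- The weight `|ξ|^m₁ (1 + t)^(-m₂)`. -/
noncomputable def weight {n : ℕ} (m₁ m₂ : ℝ) (z : Phase n) : ℝ :=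
  ‖z.2‖ ^ m₁ * (1 + z.1) ^ (-m₂)

/-- `a` is bounded by a multiple of `|ξ|^m₁ (1 + t)^(-m₂)` in the hyperbolic zone. -/
def BddOn {n : ℕ} (N m₁ m₂ : ℝ) (a : Phase n → ℂ) : Prop :=
  ∃ C : ℝ, 0 ≤ C ∧ ∀ z ∈ Zhyp n N, ‖a z‖ ≤ C * weight m₁ m₂ z

/-- `a'` is the (one-sided at `t = 0`) time derivative of `a` in the hyperbolic zone. -/
def HasTimeDeriv {n : ℕ} (N : ℝ) (a a' : Phase n → ℂ) : Prop :=
  ∀ z ∈ Zhyp n N, HasDerivWithinAt (fun τ => a (τ, z.2)) (a' z) (Set.Ici 0) z.1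

/-- Symbols of order `(m₁, m₂)` with `k` time derivatives and no regularity in `ξ`. -/
def TimeSymbol {n : ℕ} (N : ℝ) : ℕ → ℝ → ℝ → (Phase n → ℂ) → Prop
  | 0, m₁, m₂, a => BddOn N m₁ m₂ a ∧
      ∀ z ∈ Zhyp n N, ContinuousWithinAt (fun τ => a (τ, z.2)) (Set.Ici 0) z.1
  | k + 1, m₁, m₂, a => BddOn N m₁ m₂ a ∧
      ∃ a', HasTimeDeriv N a a' ∧ TimeSymbol N k m₁ (m₂ + 1) a'

variable {n d : ℕ} {N N' m₁ m₂ m₁' m₂' : ℝ} {a b : Phase n → ℂ} {z : Phase n} {k : ℕ}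

theorem Zhyp_anti (h : N ≤ N') : Zhyp n N' ⊆ Zhyp n N := fun _ hz => ⟨hz.1, h.trans hz.2⟩

theorem norm_pos_of_mem_Zhyp (hN : 0 < N) (hz : z ∈ Zhyp n N) : 0 < ‖z.2‖ := by
  refine (norm_nonneg _).lt_of_ne fun h => ?_
  have := hz.2
  rw [← h, mul_zero] at this
  linarith

theorem one_add_pos_of_mem_Zhyp (hz : z ∈ Zhyp n N) : 0 < 1 + z.1 := by linarith [hz.1]

theorem weight_pos (hN : 0 < N) (hz : z ∈ Zhyp n N) : 0 < weight m₁ m₂ z :=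
  mul_pos (Real.rpow_pos_of_pos (norm_pos_of_mem_Zhyp hN hz) _)
    (Real.rpow_pos_of_pos (one_add_pos_of_mem_Zhyp hz) _)

theorem weight_mul (hN : 0 < N) (hz : z ∈ Zhyp n N) :
    weight m₁ m₂ z * weight m₁' m₂' z = weight (m₁ + m₁') (m₂ + m₂') z := by
  simp only [weight]
  rw [Real.rpow_add (norm_pos_of_mem_Zhyp hN hz), neg_add,
    Real.rpow_add (one_add_pos_of_mem_Zhyp hz)]
  ring

theorem weight_zero : weight 0 0 z = 1 := by simp [weight]

theorem weight_neg (hN : 0 < N) (hz : z ∈ Zhyp n N) :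
    weight (-m₁) (-m₂) z = (weight m₁ m₂ z)⁻¹ := by
  refine eq_inv_of_mul_eq_one_left ?_
  rw [weight_mul hN hz, neg_add_cancel, neg_add_cancel, weight_zero]

theorem weight_neg_one_one_le (hN : 0 < N) (hz : z ∈ Zhyp n N) :
    weight (-1) 1 z ≤ N⁻¹ := by
  rw [weight, Real.rpow_neg_one, Real.rpow_neg_one, ← mul_inv]
  exact inv_anti₀ hN (by rw [mul_comm]; exact hz.2)

theorem BddOn.add (ha : BddOn N m₁ m₂ a) (hb : BddOn N m₁ m₂ b) :
    BddOn N m₁ m₂ (fun z => a z + b z) := by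
  obtain ⟨C, hC, ha⟩ := ha
  obtain ⟨D, hD, hb⟩ := hb
  refine ⟨C + D, by positivity, fun z hz => (norm_add_le _ _).trans ?_⟩
  rw [add_mul]
  exact add_le_add (ha z hz) (hb z hz)

theorem BddOn.neg (ha : BddOn N m₁ m₂ a) : BddOn N m₁ m₂ (fun z => -a z) := by
  simpa only [BddOn, norm_neg] using ha

theorem BddOn.mul (hN : 0 < N) (ha : BddOn N m₁ m₂ a) (hb : BddOn N m₁' m₂' b) :
    BddOn N (m₁ + m₁') (m₂ + m₂') (fun z => a z * b z) := by
  obtain ⟨C, hC, ha⟩ := ha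
  obtain ⟨D, hD, hb⟩ := hb
  refine ⟨C * D, by positivity, fun z hz => ?_⟩
  rw [norm_mul, ← weight_mul hN hz]
  calc _ ≤ (C * weight m₁ m₂ z) * (D * weight m₁' m₂' z) :=
        mul_le_mul (ha z hz) (hb z hz) (norm_nonneg _)
          (mul_nonneg hC (weight_pos hN hz).le)
    _ = _ := by ring

theorem BddOn.inv (hN : 0 < N) {c : ℝ} (hc : 0 < c)
    (h : ∀ z ∈ Zhyp n N, c * weight m₁ m₂ z ≤ ‖a z‖) :
    BddOn N (-m₁) (-m₂) (fun z => (a z)⁻¹) := by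
  refine ⟨c⁻¹, by positivity, fun z hz => ?_⟩
  rw [weight_neg hN hz, norm_inv, ← mul_inv]
  exact inv_anti₀ (mul_pos hc (weight_pos hN hz)) (h z hz)

/-- In the zone `|ξ|⁻¹ (1 + t)⁻¹ ≤ 1/N`, so trading one order of `ξ` for one of decay costs only a
constant. -/
theorem BddOn.embed (hN : 0 < N) (ha : BddOn N (m₁ - 1) (m₂ + 1) a) : BddOn N m₁ m₂ a := by
  obtain ⟨C, hC, ha⟩ := ha
  refine ⟨C * N⁻¹, by positivity, fun z hz => (ha z hz).trans ?_⟩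
  rw [show m₁ - 1 = m₁ + -1 by ring, ← weight_mul hN hz, mul_assoc, mul_comm (weight _ _ _)]
  have := weight_pos (m₁ := m₁) (m₂ := m₂) hN hz
  gcongr
  exact weight_neg_one_one_le hN hz

theorem TimeSymbol.bddOn (h : TimeSymbol N k m₁ m₂ a) : BddOn N m₁ m₂ a := by
  cases k <;> exact h.1

theorem TimeSymbol.continuousWithinAt (h : TimeSymbol N k m₁ m₂ a) (hz : z ∈ Zhyp n N) :
    ContinuousWithinAt (fun τ => a (τ, z.2)) (Set.Ici 0) z.1 := by
  cases k with
  | zero => exact h.2 z hz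
  | succ k =>
    obtain ⟨-, a', ha', -⟩ := h
    exact (ha' z hz).continuousWithinAt

theorem TimeSymbol.of_succ (h : TimeSymbol N (k + 1) m₁ m₂ a) : TimeSymbol N k m₁ m₂ a := by
  induction k generalizing m₂ a with
  | zero => exact ⟨h.bddOn, fun z hz => h.continuousWithinAt hz⟩
  | succ k ih =>
    obtain ⟨hb, a', ha', hs⟩ := h
    exact ⟨hb, a', ha', ih hs⟩

theorem TimeSymbol.to_zero (h : TimeSymbol N k m₁ m₂ a) : TimeSymbol N 0 m₁ m₂ a :=
  ⟨h.bddOn, fun _ hz => h.continuousWithinAt hz⟩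

theorem TimeSymbol.add (ha : TimeSymbol N k m₁ m₂ a) (hb : TimeSymbol N k m₁ m₂ b) :
    TimeSymbol N k m₁ m₂ (fun z => a z + b z) := by
  induction k generalizing m₂ a b with
  | zero => exact ⟨ha.1.add hb.1, fun z hz => (ha.2 z hz).add (hb.2 z hz)⟩
  | succ k ih =>
    obtain ⟨h1, a', ha', hs⟩ := ha
    obtain ⟨h2, b', hb', hs'⟩ := hb
    exact ⟨h1.add h2, _, fun z hz => (ha' z hz).add (hb' z hz), ih hs hs'⟩

theorem TimeSymbol.neg (ha : TimeSymbol N k m₁ m₂ a) :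
    TimeSymbol N k m₁ m₂ (fun z => -a z) := by
  induction k generalizing m₂ a with
  | zero => exact ⟨ha.1.neg, fun z hz => (ha.2 z hz).neg⟩
  | succ k ih =>
    obtain ⟨h1, a', ha', hs⟩ := ha
    exact ⟨h1.neg, _, fun z hz => (ha' z hz).neg, ih hs⟩

theorem TimeSymbol.sub (ha : TimeSymbol N k m₁ m₂ a) (hb : TimeSymbol N k m₁ m₂ b) :
    TimeSymbol N k m₁ m₂ (fun z => a z - b z) := by
  simpa only [sub_eq_add_neg] using ha.add hb.neg

theorem TimeSymbol.mul (hN : 0 < N) (ha : TimeSymbol N k m₁ m₂ a)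
    (hb : TimeSymbol N k m₁' m₂' b) :
    TimeSymbol N k (m₁ + m₁') (m₂ + m₂') (fun z => a z * b z) := by
  induction k generalizing m₂ m₂' a b with
  | zero => exact ⟨ha.1.mul hN hb.1, fun z hz => (ha.2 z hz).mul (hb.2 z hz)⟩
  | succ k ih =>
    have ha0 := ha.of_succ
    have hb0 := hb.of_succ
    obtain ⟨h1, a', ha', hs⟩ := ha
    obtain ⟨h2, b', hb', hs'⟩ := hb
    refine ⟨h1.mul hN h2, _, fun z hz => (ha' z hz).mul (hb' z hz), ?_⟩
    refine TimeSymbol.add ?_ ?_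
    · convert ih hs hb0 using 1; ring
    · convert ih ha0 hs' using 1; ring

theorem TimeSymbol.congr (ha : TimeSymbol N k m₁ m₂ a) (h₁ : m₁ = m₁') (h₂ : m₂ = m₂') :
    TimeSymbol N k m₁' m₂' a := h₁ ▸ h₂ ▸ ha

theorem TimeSymbol.zero : TimeSymbol N k m₁ m₂ (fun _ : Phase n => 0) := by
  have hb : ∀ m₂, BddOn N m₁ m₂ (fun _ : Phase n => 0) := fun m₂ => ⟨0, le_rfl, by simp⟩
  induction k generalizing m₂ with
  | zero => exact ⟨hb _, fun z hz => continuousWithinAt_const⟩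
  | succ k ih => exact ⟨hb _, _, fun z hz => hasDerivWithinAt_const _ _ _, ih⟩

theorem TimeSymbol.sum {ι : Type*} (s : Finset ι) {f : ι → Phase n → ℂ}
    (h : ∀ i ∈ s, TimeSymbol N k m₁ m₂ (f i)) :
    TimeSymbol N k m₁ m₂ (fun z => ∑ i ∈ s, f i z) := by
  classical
  induction s using Finset.induction_on with
  | empty => simpa using TimeSymbol.zero
  | insert i s hi ih =>
    simp only [Finset.sum_insert hi]
    exact (h i (Finset.mem_insert_self _ _)).add
      (ih fun j hj => h j (Finset.mem_insert_of_mem hj))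

/-- The derivative `-a'/a²` involves the inverse with one derivative fewer, which the induction
already controls. -/
theorem TimeSymbol.inv (hN : 0 < N) (ha : TimeSymbol N k m₁ m₂ a) {c : ℝ} (hc : 0 < c)
    (h : ∀ z ∈ Zhyp n N, c * weight m₁ m₂ z ≤ ‖a z‖) :
    TimeSymbol N k (-m₁) (-m₂) (fun z => (a z)⁻¹) := by
  have h0 : ∀ z ∈ Zhyp n N, a z ≠ 0 := fun z hz =>
    norm_pos_iff.1 ((mul_pos hc (weight_pos hN hz)).trans_le (h z hz))
  induction k with
  | zero => exact ⟨BddOn.inv hN hc h, fun z hz => (ha.2 z hz).inv₀ (h0 z hz)⟩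
  | succ k ih =>
    have hi := ih ha.of_succ
    obtain ⟨h1, a', ha', hs⟩ := ha
    refine ⟨BddOn.inv hN hc h, fun z => -(a' z * ((a z)⁻¹ * (a z)⁻¹)), fun z hz => ?_, ?_⟩
    · refine ((ha' z hz).inv (h0 z hz)).congr_deriv ?_
      rw [neg_div, div_eq_mul_inv, sq, mul_inv]
    · exact (hs.mul hN (hi.mul hN hi)).neg.congr (by ring) (by ring)

theorem TimeSymbol.embed (hN : 0 < N) (ha : TimeSymbol N k (m₁ - 1) (m₂ + 1) a) :
    TimeSymbol N k m₁ m₂ a := by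
  induction k generalizing m₂ a with
  | zero => exact ⟨ha.1.embed hN, ha.2⟩
  | succ k ih =>
    obtain ⟨h1, a', ha', hs⟩ := ha
    exact ⟨h1.embed hN, a', ha', ih hs⟩

/-! ### From symbol classes to time derivatives -/

/-- The half space `t ≥ 0` of the extended phase space. -/
def halfSpace (n : ℕ) : Set (Phase n) := {z | 0 ≤ z.1}

theorem uniqueDiffOn_halfSpace : UniqueDiffOn ℝ (halfSpace n) := by
  have : halfSpace n = Set.Ici (0 : ℝ) ×ˢ Set.univ := by ext z; simp [halfSpace]
  rw [this]
  exact (uniqueDiffOn_Ici 0).prod uniqueDiffOn_univ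

/-- Away from the curved boundary only `t ≥ 0` is a constraint. Derivatives within the zone can
therefore be taken within the half space, where they are unique, at the price of enlarging `N`
slightly. -/
theorem Zhyp_eventuallyEq_halfSpace (h : N < (1 + z.1) * ‖z.2‖) :
    Zhyp n N =ᶠ[nhds z] halfSpace n := by
  have hc : Continuous fun w : Phase n => (1 + w.1) * ‖w.2‖ := by fun_prop
  filter_upwards [hc.continuousAt.eventually (lt_mem_nhds h)] with w hw
  exact propext ⟨fun hz => hz.1, fun hz => ⟨hz, hw.le⟩⟩

/-- The `k`-th time derivative, one-sided at `t = 0`. -/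
noncomputable def timeDeriv {n : ℕ} (k : ℕ) (a : Phase n → ℂ) (z : Phase n) : ℂ :=
  iteratedFDerivWithin ℝ k a (halfSpace n) z (fun _ => ((1, 0) : Phase n))

theorem contDiffWithinAt_halfSpace (ha : ContDiffOn ℝ ∞ a (Zhyp n N)) (hz0 : 0 ≤ z.1)
    (hz : N < (1 + z.1) * ‖z.2‖) : ContDiffWithinAt ℝ ∞ a (halfSpace n) z :=
  (ha z ⟨hz0, hz.le⟩).congr_set (Zhyp_eventuallyEq_halfSpace hz)

theorem hasTimeDeriv_timeDeriv (ha : ContDiffOn ℝ ∞ a (Zhyp n N)) (hNN : N < N') :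
    HasTimeDeriv N' (timeDeriv k a) (timeDeriv (k + 1) a) := by
  intro z hz
  have hd := contDiffWithinAt_halfSpace ha hz.1 (hNN.trans_le hz.2)
  have h1 := (hd.differentiableWithinAt_iteratedFDerivWithin (m := k)
    (by exact_mod_cast WithTop.coe_lt_coe.2 (ENat.natCast_lt_top k))
    (by rw [Set.insert_eq_of_mem (show z ∈ halfSpace n from hz.1)]
        exact uniqueDiffOn_halfSpace)).hasFDerivWithinAt
  have h2 : HasDerivWithinAt (fun τ : ℝ => ((τ, z.2) : Phase n)) ((1, 0) : Phase n)
      (Set.Ici 0) z.1 :=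
    (hasDerivWithinAt_id _ _).prodMk (hasDerivWithinAt_const _ _ _)
  have h3 := h1.comp_hasDerivWithinAt (f := fun τ : ℝ => ((τ, z.2) : Phase n)) z.1 h2
    (fun τ hτ => hτ)
  have h4 := ((ContinuousMultilinearMap.apply ℝ (fun _ : Fin k => Phase n) ℂ
    (fun _ => ((1, 0) : Phase n))).hasFDerivAt).comp_hasDerivWithinAt z.1 h3
  exact h4

theorem timeDeriv_eq_mixedDeriv (hz : N < (1 + z.1) * ‖z.2‖) (e : Fin 0 → Fin n) :
    mixedDeriv N k e a z = timeDeriv k a z := by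
  rw [mixedDeriv, timeDeriv, iteratedFDerivWithin_congr_set (Zhyp_eventuallyEq_halfSpace hz)]
  congr 1
  rw [Fin.append_right_nil _ _ rfl]
  rfl

theorem timeDeriv_zero : timeDeriv 0 a = a := by
  funext z; simp [timeDeriv]

theorem fderivWithin_Zhyp_eq_timeDeriv (hz0 : 0 ≤ z.1) (hz : N < (1 + z.1) * ‖z.2‖) :
    fderivWithin ℝ a (Zhyp n N) z ((1, 0) : Phase n) = timeDeriv 1 a z := by
  rw [timeDeriv, iteratedFDerivWithin_one_apply (uniqueDiffOn_halfSpace z hz0),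
    fderivWithin_congr_set (Zhyp_eventuallyEq_halfSpace hz)]

theorem IsSymbolOn.timeSymbol_timeDeriv (h : IsSymbolOn N m₁ m₂ a) (hNN : N < N') (j : ℕ) :
    TimeSymbol N' k m₁ (m₂ + j) (timeDeriv j a) := by
  have hb : ∀ j : ℕ, BddOn N' m₁ (m₂ + j) (timeDeriv j a) := by
    intro j
    -- Only the estimates with the empty multi-index in `ξ` are used.
    obtain ⟨C, hC⟩ := h.2 j 0 Fin.elim0
    refine ⟨|C|, abs_nonneg _, fun z hz => ?_⟩
    have hz' := hNN.trans_le hz.2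
    have := hC z ⟨hz.1, hz'.le⟩
    rw [timeDeriv_eq_mixedDeriv hz'] at this
    refine this.trans ?_
    have h1 : 0 < 1 + z.1 := one_add_pos_of_mem_Zhyp hz
    rw [weight, one_div, Real.inv_rpow h1.le, Real.rpow_neg h1.le, mul_assoc, Nat.cast_zero,
      sub_zero]
    gcongr
    exact le_abs_self C
  induction k generalizing j with
  | zero =>
    exact ⟨hb j, fun z hz => (hasTimeDeriv_timeDeriv h.1 hNN z hz).continuousWithinAt⟩
  | succ k ih =>
    refine ⟨hb j, _, hasTimeDeriv_timeDeriv h.1 hNN, ?_⟩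
    have := ih (j + 1)
    rwa [Nat.cast_add_one, ← add_assoc] at this

theorem IsSymbol.eventually_timeSymbol_timeDeriv (h : IsSymbol m₁ m₂ a) (k j : ℕ) :
    ∀ᶠ N in Filter.atTop, TimeSymbol N k m₁ (m₂ + j) (timeDeriv j a) ∧
      HasTimeDeriv N (timeDeriv j a) (timeDeriv (j + 1) a) := by
  obtain ⟨N, -, h⟩ := h
  filter_upwards [Filter.eventually_gt_atTop N] with N' hN'
  exact ⟨h.timeSymbol_timeDeriv hN' j, hasTimeDeriv_timeDeriv h.1 hN'⟩

theorem IsSymbol.eventually_timeSymbol (h : IsSymbol m₁ m₂ a) (k : ℕ) :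
    ∀ᶠ N in Filter.atTop, TimeSymbol N k m₁ m₂ a := by
  filter_upwards [h.eventually_timeSymbol_timeDeriv k 0] with N hN
  simpa [timeDeriv_zero] using hN.1

/-! ### Estimates for diagonally dominated systems -/

/-- Duhamel's principle as a differential inequality: the factor `exp (i ∫_τ^t g)` removes `g` and
equals `1` at `τ = t`. -/
theorem norm_le_of_scalar_equation {u ρ g : ℝ → ℂ} {s t : ℝ} (hst : s ≤ t)
    (hg : ContinuousOn g (Set.Icc s t))
    (hu : ∀ τ ∈ Set.Icc s t,
      HasDerivWithinAt u (Complex.I * (g τ * u τ + ρ τ)) (Set.Ici s) τ)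
    {B B' : ℝ → ℝ} (hB : ∀ τ ∈ Set.Icc s t, HasDerivAt B (B' τ) τ)
    (h0 : Real.exp (-(∫ σ in s..t, g σ).im) * ‖u s‖ ≤ B s)
    (hb : ∀ τ ∈ Set.Icc s t, Real.exp (-(∫ σ in τ..t, g σ).im) * ‖ρ τ‖ ≤ B' τ) :
    ‖u t‖ ≤ B t := by
  -- A continuous extension makes the phase differentiable at the endpoints as well.
  set G : ℝ → ℂ := Set.IccExtend hst ((Set.Icc s t).domRestrict g) with hG
  have hGc : Continuous G := (continuousOn_iff_continuous_domRestrict.1 hg).Icc_extend'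
  have hGg : ∀ τ ∈ Set.Icc s t, G τ = g τ := fun τ hτ => by
    rw [hG, Set.IccExtend_of_mem hst _ hτ]; rfl
  set φ : ℝ → ℂ := fun τ => ∫ σ in τ..t, G σ with hφ
  have hφ' : ∀ τ, HasDerivAt φ (-G τ) τ := fun τ =>
    intervalIntegral.integral_hasDerivAt_left (hGc.intervalIntegrable _ _)
      (hGc.stronglyMeasurableAtFilter _ _) hGc.continuousAt
  have hφg : ∀ τ ∈ Set.Icc s t, φ τ = ∫ σ in τ..t, g σ := fun τ hτ =>
    intervalIntegral.integral_congr fun σ hσ => hGg σ (by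
      rw [Set.uIcc_of_le hτ.2] at hσ
      exact ⟨hτ.1.trans hσ.1, hσ.2⟩)
  have hn : ∀ τ, ‖Complex.exp (Complex.I * φ τ)‖ = Real.exp (-(φ τ).im) := fun τ => by
    rw [Complex.norm_exp]; simp
  have hh : ∀ τ ∈ Set.Icc s t, HasDerivWithinAt (fun τ => Complex.exp (Complex.I * φ τ) * u τ)
      (Complex.I * (Complex.exp (Complex.I * φ τ) * ρ τ)) (Set.Ici s) τ := by
    intro τ hτ
    refine ((((hφ' τ).const_mul Complex.I).cexp.hasDerivWithinAt).mul (hu τ hτ)).congr_deriv ?_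
    rw [hGg τ hτ]; ring
  have := image_norm_le_of_norm_deriv_right_le_deriv_boundary'
    (f := fun τ => Complex.exp (Complex.I * φ τ) * u τ) (a := s) (b := t)
    (fun τ hτ => (hh τ hτ).continuousWithinAt.mono Set.Icc_subset_Ici_self)
    (fun τ hτ => (hh τ ⟨hτ.1, hτ.2.le⟩).mono (Set.Ici_subset_Ici.2 hτ.1))
    (B := B) (B' := B')
    (by rw [norm_mul, hn, hφg s ⟨le_rfl, hst⟩]; exact h0)
    (fun τ hτ => (hB τ hτ).continuousAt.continuousWithinAt)
    (fun τ hτ => (hB τ ⟨hτ.1, hτ.2.le⟩).hasDerivWithinAt)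
    (fun τ hτ => by
      rw [norm_mul, norm_mul, Complex.norm_I, one_mul, hn, hφg τ ⟨hτ.1, hτ.2.le⟩]
      exact hb τ ⟨hτ.1, hτ.2.le⟩) ⟨hst, le_rfl⟩
  simpa [hφ] using this

/-- Let `Y` be the maximum of `‖w‖ (1 + τ)^κ` on `[s, t]`. Duhamel bounds `Y` by the initial datum
plus `e^(-c) b (1 + s)⁻¹ Y`, and the smallness condition allows this last term, at most `Y/2`, to be
absorbed. -/
theorem norm_le_of_diagonal_dominated_system {d : ℕ} {s κ c b : ℝ} (hs : 0 ≤ s) (hb0 : 0 ≤ b)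
    {w ρ : ℝ → Fin d → ℂ} {D : Fin d → ℝ → ℝ} {f : Fin d → ℝ → ℂ}
    (hD : ∀ j, ContinuousOn (D j) (Set.Ici s)) (hf : ∀ j, ContinuousOn (f j) (Set.Ici s))
    (hw : ∀ j, ∀ τ, s ≤ τ → HasDerivWithinAt (fun τ => w τ j)
      (Complex.I * (((D j τ : ℂ) + f j τ) * w τ j + ρ τ j)) (Set.Ici s) τ)
    (hlow : ∀ j, ∀ s' t, s ≤ s' → s' ≤ t →
      κ * Real.log ((1 + t) / (1 + s')) + c ≤ (∫ τ in s'..t, f j τ).im)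
    (hρ : ∀ j, ∀ τ, s ≤ τ → ‖ρ τ j‖ ≤ b * ((1 + τ) ^ 2)⁻¹ * ‖w τ‖)
    (hb : Real.exp (-c) * b * (1 + s)⁻¹ ≤ 1 / 2) {t : ℝ} (hst : s ≤ t) :
    ‖w t‖ ≤ 2 * Real.exp (-c) * ((1 + t) / (1 + s)) ^ (-κ) * ‖w s‖ := by
  have hpos : ∀ τ, s ≤ τ → 0 < 1 + τ := fun τ hτ => by linarith
  have hwc : ContinuousOn w (Set.Ici s) :=
    continuousOn_pi.2 fun j τ hτ => (hw j τ hτ).continuousWithinAt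
  have hyc : ContinuousOn (fun τ => ‖w τ‖ * (1 + τ) ^ κ) (Set.Icc s t) := by
    refine (hwc.mono Set.Icc_subset_Ici_self).norm.mul ?_
    exact ContinuousOn.rpow_const (by fun_prop) fun τ hτ => Or.inl (hpos τ hτ.1).ne'
  obtain ⟨σ, hσ, hmax⟩ := isCompact_Icc.exists_isMaxOn (Set.nonempty_Icc.2 hst) hyc
  set Y : ℝ := ‖w σ‖ * (1 + σ) ^ κ with hY
  have hY0 : 0 ≤ Y := mul_nonneg (norm_nonneg _) (Real.rpow_nonneg (hpos σ hσ.1).le _)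
  have hYmax : ∀ τ ∈ Set.Icc s t, ‖w τ‖ * (1 + τ) ^ κ ≤ Y := fun τ hτ => hmax hτ
  -- The real part `D` of the exponent drops out of the imaginary part, however large it is.
  have hfactor : ∀ j, ∀ τ, s ≤ τ → ∀ r, τ ≤ r →
      Real.exp (-(∫ σ in τ..r, ((D j σ : ℂ) + f j σ)).im) ≤
        Real.exp (-c) * ((1 + r) ^ (-κ) * (1 + τ) ^ κ) := by
    intro j τ hτ r hr
    have hsub : Set.uIcc τ r ⊆ Set.Ici s := by
      rw [Set.uIcc_of_le hr]; exact fun x hx => hτ.trans hx.1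
    have hDc : ContinuousOn (fun σ => (D j σ : ℂ)) (Set.Ici s) :=
      Complex.continuous_ofReal.comp_continuousOn (hD j)
    rw [intervalIntegral.integral_add (hDc.mono hsub).intervalIntegrable
      ((hf j).mono hsub).intervalIntegrable, intervalIntegral.integral_ofReal, Complex.add_im,
      Complex.ofReal_im, zero_add]
    have h1 := hpos τ hτ
    have h2 : 0 < 1 + r := by linarith
    have h3 := hlow j τ r hτ hr
    have h4 : (1 + r) ^ (-κ) * (1 + τ) ^ κ =
        Real.exp (-(κ * Real.log ((1 + r) / (1 + τ)))) := by
      rw [Real.rpow_def_of_pos h1, Real.rpow_def_of_pos h2, ← Real.exp_add,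
        Real.log_div h2.ne' h1.ne']
      congr 1; ring
    rw [h4, ← Real.exp_add]
    exact Real.exp_le_exp.2 (by linarith)
  have hcomp : ∀ r ∈ Set.Icc s t, ‖w r‖ ≤
      Real.exp (-c) * ((1 + r) ^ (-κ) * (1 + s) ^ κ) * ‖w s‖ + (1 + r) ^ (-κ) * (Y / 2) := by
    intro r hr
    have hr0 := hpos r hr.1
    have hrk : 0 < (1 + r) ^ (-κ) := Real.rpow_pos_of_pos hr0 _
    have hsk : 0 < (1 + s) ^ κ := Real.rpow_pos_of_pos (hpos s le_rfl) _
    refine (pi_norm_le_iff_of_nonneg (by positivity)).2 fun j => ?_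
    have key := norm_le_of_scalar_equation (u := fun τ => w τ j) (ρ := fun τ => ρ τ j)
      (g := fun τ => (D j τ : ℂ) + f j τ) hr.1
      (((Complex.continuous_ofReal.comp_continuousOn (hD j)).add (hf j)).mono
        Set.Icc_subset_Ici_self)
      (fun τ hτ => hw j τ hτ.1)
      -- The majorant is the datum term plus the explicit integral of `(1 + τ)⁻²` from `s`.
      (B := fun τ => Real.exp (-c) * ((1 + r) ^ (-κ) * (1 + s) ^ κ) * ‖w s‖ +
        Real.exp (-c) * (1 + r) ^ (-κ) * Y * b * ((1 + s)⁻¹ - (1 + τ)⁻¹))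
      (B' := fun τ => Real.exp (-c) * (1 + r) ^ (-κ) * Y * b * ((1 + τ) ^ 2)⁻¹) ?_ ?_ ?_
    · refine key.trans (add_le_add le_rfl ?_)
      calc Real.exp (-c) * (1 + r) ^ (-κ) * Y * b * ((1 + s)⁻¹ - (1 + r)⁻¹)
          ≤ Real.exp (-c) * (1 + r) ^ (-κ) * Y * b * (1 + s)⁻¹ := by
            gcongr
            linarith [inv_pos.2 hr0]
        _ = (1 + r) ^ (-κ) * (Y * (Real.exp (-c) * b * (1 + s)⁻¹)) := by ring
        _ ≤ (1 + r) ^ (-κ) * (Y * (1 / 2)) := by gcongr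
        _ = _ := by ring
    · intro τ hτ
      have h1 := (((hasDerivAt_id τ).const_add 1).inv (hpos τ hτ.1).ne').const_sub (1 + s)⁻¹
      refine ((h1.const_mul (Real.exp (-c) * (1 + r) ^ (-κ) * Y * b)).const_add _).congr_deriv ?_
      simp [neg_div]
    · simp only [sub_self, mul_zero, add_zero]
      exact mul_le_mul (hfactor j s le_rfl r hr.1) (norm_le_pi_norm _ j) (norm_nonneg _)
        (by positivity)
    · intro τ hτ
      have hτ0 := hpos τ hτ.1
      have hτk : 0 < (1 + τ) ^ κ := Real.rpow_pos_of_pos hτ0 _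
      calc _ ≤ Real.exp (-c) * ((1 + r) ^ (-κ) * (1 + τ) ^ κ) *
            (b * ((1 + τ) ^ 2)⁻¹ * ‖w τ‖) :=
            mul_le_mul (hfactor j τ hτ.1 r hτ.2) (hρ j τ hτ.1) (norm_nonneg _) (by positivity)
        _ = Real.exp (-c) * (1 + r) ^ (-κ) * (‖w τ‖ * (1 + τ) ^ κ) * b * ((1 + τ) ^ 2)⁻¹ := by
            ring
        _ ≤ _ := by
            gcongr
            exact hYmax τ ⟨hτ.1, hτ.2.trans hr.2⟩
  have hcancel : ∀ r, s ≤ r → (1 + r) ^ (-κ) * (1 + r) ^ κ = 1 := fun r hr => by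
    rw [← Real.rpow_add (hpos r hr), neg_add_cancel, Real.rpow_zero]
  have hYs : Y ≤ 2 * Real.exp (-c) * (1 + s) ^ κ * ‖w s‖ := by
    have h1 := mul_le_mul_of_nonneg_right (hcomp σ hσ)
      (Real.rpow_nonneg (hpos σ hσ.1).le κ)
    have h2 : (Real.exp (-c) * ((1 + σ) ^ (-κ) * (1 + s) ^ κ) * ‖w s‖ +
        (1 + σ) ^ (-κ) * (Y / 2)) * (1 + σ) ^ κ =
        (Real.exp (-c) * (1 + s) ^ κ * ‖w s‖ + Y / 2) * ((1 + σ) ^ (-κ) * (1 + σ) ^ κ) := by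
      ring
    rw [h2, hcancel σ hσ.1, ← hY] at h1
    linarith
  have h1 : ‖w t‖ = (1 + t) ^ (-κ) * (‖w t‖ * (1 + t) ^ κ) := by
    rw [mul_comm ‖w t‖, ← mul_assoc, hcancel t hst, one_mul]
  rw [h1, Real.div_rpow (hpos t hst).le (hpos s le_rfl).le, Real.rpow_neg (hpos s le_rfl).le κ,
    div_inv_eq_mul]
  have h2 : 0 ≤ (1 + t) ^ (-κ) := Real.rpow_nonneg (hpos t hst).le _
  calc _ ≤ (1 + t) ^ (-κ) * (2 * Real.exp (-c) * (1 + s) ^ κ * ‖w s‖) :=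
        mul_le_mul_of_nonneg_left ((hYmax t ⟨hst, le_rfl⟩).trans hYs) h2
    _ = _ := by ring

/-! ### Matrix bounds and the two diagonalisation steps -/

theorem exists_opNorm_le (d : ℕ) : ∃ C : ℝ, 0 ≤ C ∧ ∀ (B : Matrix (Fin d) (Fin d) ℂ) (β : ℝ),
    (∀ i j, ‖B i j‖ ≤ β) → opNorm B ≤ C * β := by
  refine ⟨∑ i, ∑ j, opNorm (d := d) (Matrix.single i j (1 : ℂ)),
    Finset.sum_nonneg fun i _ => Finset.sum_nonneg fun j _ => norm_nonneg _, fun B β hB => ?_⟩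
  have h : B = ∑ i, ∑ j, B i j • Matrix.single i j (1 : ℂ) := by
    conv_lhs => rw [Matrix.matrix_eq_sum_single B]
    simp [Matrix.smul_single]
  conv_lhs => rw [h, opNorm, map_sum]
  rw [Finset.sum_mul]
  refine (norm_sum_le _ _).trans (Finset.sum_le_sum fun i _ => ?_)
  rw [map_sum, Finset.sum_mul]
  refine (norm_sum_le _ _).trans (Finset.sum_le_sum fun j _ => ?_)
  rw [map_smul, norm_smul, mul_comm]
  exact mul_le_mul_of_nonneg_left (hB i j) (norm_nonneg _)

theorem norm_mul_apply_le {B V : Matrix (Fin d) (Fin d) ℂ} {β : ℝ} (hB : ∀ i j, ‖B i j‖ ≤ β)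
    (i q : Fin d) : ‖(B * V) i q‖ ≤ d * β * ‖fun j => V j q‖ := by
  rw [Matrix.mul_apply]
  refine (norm_sum_le_of_le (f := fun j => B i j * V j q)
    (n := fun _ => β * ‖fun j => V j q‖) _ fun j _ => ?_).trans (by simp [mul_assoc])
  rw [norm_mul]
  exact mul_le_mul (hB i j) (norm_le_pi_norm (fun j => V j q) j) (norm_nonneg _)
    ((norm_nonneg _).trans (hB i j))

theorem hasDerivWithinAt_matrix_mul {B C : ℝ → Matrix (Fin d) (Fin d) ℂ}
    {B' C' : Matrix (Fin d) (Fin d) ℂ} {S : Set ℝ} {t : ℝ}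
    (hB : ∀ i j, HasDerivWithinAt (fun τ => B τ i j) (B' i j) S t)
    (hC : ∀ i j, HasDerivWithinAt (fun τ => C τ i j) (C' i j) S t) (i j : Fin d) :
    HasDerivWithinAt (fun τ => (B τ * C τ) i j) ((B' * C t + B t * C') i j) S t := by
  simp only [Matrix.mul_apply, Matrix.add_apply, ← Finset.sum_add_distrib]
  exact HasDerivWithinAt.fun_sum fun l _ => (hB i l).mul (hC l j)

/-- The algebraic identity behind the second diagonalisation step. -/
theorem second_step_identity (D f : Fin d → ℂ) (R K K' : Matrix (Fin d) (Fin d) ℂ)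
    (hK : ∀ i j, R i j - K i j * D j = (if i = j then R i i else 0) - D i * K i j) :
    Matrix.diagonal D + R + Complex.I • K' - K * (Matrix.diagonal D + R) =
      (Matrix.diagonal D + Matrix.diagonal f) * (1 - K) +
        (Matrix.diagonal f * K + (Matrix.diagonal (fun i => R i i - f i)) - K * R +
          Complex.I • K') := by
  ext i j
  have h := hK i j
  have h1 : (Matrix.diagonal fun i => R i i - f i) i j =
      (if i = j then R i i else 0) - Matrix.diagonal f i j := by
    by_cases hij : i = j <;> simp [hij]
  simp only [mul_add, add_mul, mul_sub, mul_one, Matrix.add_apply, Matrix.sub_apply,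
    Matrix.mul_diagonal, Matrix.diagonal_mul, h1]
  linear_combination h

/-- Similar matrices share their characteristic polynomial, and its roots `ev` are distinct; hence
the diagonal entries are a permutation of `ev` and inherit reality and separation. -/
theorem eigenvalue_of_diagonalised {B M : Matrix (Fin d) (Fin d) ℂ} {ev : Fin d → ℝ} {δ : ℝ}
    (hδ : 0 < δ) (hM : IsUnit M.det) (hdiag : (M⁻¹ * B * M).IsDiag)
    (hchar : B.charpoly = ∏ j, (Polynomial.X - Polynomial.C ((ev j : ℝ) : ℂ)))
    (hsep : ∀ i j, i ≠ j → δ ≤ |ev i - ev j|) :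
    (∀ j, (((M⁻¹ * B * M) j j).re : ℂ) = (M⁻¹ * B * M) j j) ∧
      ∀ i j, i ≠ j → δ ≤ ‖(M⁻¹ * B * M) i i - (M⁻¹ * B * M) j j‖ := by
  set D : Fin d → ℂ := fun j => (M⁻¹ * B * M) j j with hD
  have hprod : ∏ j, (Polynomial.X - Polynomial.C (D j)) =
      ∏ j, (Polynomial.X - Polynomial.C ((ev j : ℝ) : ℂ)) := by
    rw [← hchar, ← Matrix.charpoly_diagonal, show Matrix.diagonal D = M⁻¹ * B * M from
      hdiag.diagonal_diag, Matrix.charpoly_mul_comm, ← mul_assoc, Matrix.mul_nonsing_inv _ hM,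
      one_mul]
  have heval : ∀ x : ℂ, ∏ j, (x - D j) = ∏ j, (x - ev j) := fun x => by
    simpa [Polynomial.eval_prod] using congrArg (Polynomial.eval x) hprod
  have h1 : ∀ i, ∃ j, D i = ev j := fun i => by
    have : ∏ j, (D i - ev j) = 0 := by
      rw [← heval]; exact Finset.prod_eq_zero (Finset.mem_univ i) (sub_self _)
    obtain ⟨j, -, hj⟩ := Finset.prod_eq_zero_iff.1 this
    exact ⟨j, sub_eq_zero.1 hj⟩
  choose σ hσ using h1
  have hinj : Function.Injective ev := fun i j hij => by
    by_contra hne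
    have := hsep i j hne
    rw [hij, sub_self, abs_zero] at this
    linarith
  have hsurj : Function.Surjective σ := fun i => by
    have : ∏ j, ((ev i : ℂ) - D j) = 0 := by
      rw [heval]; exact Finset.prod_eq_zero (Finset.mem_univ i) (sub_self _)
    obtain ⟨j, -, hj⟩ := Finset.prod_eq_zero_iff.1 this
    refine ⟨j, hinj ?_⟩
    have h2 := sub_eq_zero.1 hj
    rw [hσ j] at h2
    exact_mod_cast h2.symm
  have hσi : Function.Injective σ := Finite.injective_iff_surjective.2 hsurj
  refine ⟨fun j => ?_, fun i j hij => ?_⟩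
  · change ((D j).re : ℂ) = D j
    rw [hσ j, Complex.ofReal_re]
  · change δ ≤ ‖D i - D j‖
    rw [hσ i, hσ j, ← Complex.ofReal_sub, Complex.norm_real, Real.norm_eq_abs]
    exact hsep _ _ fun h => hij (hσi h)

/-- This turns the product rule for `PE`, with `P = M⁻¹`, into the equation `D_t V = X V`. -/
theorem first_step_identity {A M P P' E X : Matrix (Fin d) (Fin d) ℂ} (hE : E = M * (P * E))
    (h : P * A * M + (-Complex.I) • P' * M = X) :
    P' * E + P * (Complex.I • (A * E)) = Complex.I • (X * (P * E)) := by
  have h1 : X * (P * E) = P * A * E + (-Complex.I) • (P' * E) := by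
    rw [← h, add_mul, mul_assoc _ M, mul_assoc _ M, ← hE, Matrix.smul_mul]
  rw [h1, smul_add, smul_smul, Matrix.mul_smul, mul_neg, Complex.I_mul_I, neg_neg, one_smul,
    add_comm, mul_assoc]

/-- The same for `W = (1 - K)V`; the remainder acts on `V`, so `1 - K` need not be inverted. -/
theorem conjugation_identity {K K' V X Y Q : Matrix (Fin d) (Fin d) ℂ}
    (h : X + Complex.I • K' - K * X = Y * (1 - K) + Q) :
    -K' * V + (1 - K) * (Complex.I • (X * V)) =
      Complex.I • (Y * ((1 - K) * V) + Q * V) := by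
  rw [← mul_assoc, ← add_mul, ← h, sub_mul _ _ V, add_mul, smul_sub, smul_add, Matrix.smul_mul,
    smul_smul, Complex.I_mul_I, Matrix.mul_smul, sub_mul, one_mul, smul_sub, neg_smul, one_smul,
    Matrix.neg_mul, mul_assoc]
  abel

theorem entry_bound_of_diagonalised_system {s κ c r CK CR CM CP : ℝ} (hs : 0 ≤ s) (hr : 0 ≤ r)
    (hCR : 0 ≤ CR)
    {A M P P' R K K' E : ℝ → Matrix (Fin d) (Fin d) ℂ} {D : Fin d → ℝ → ℝ}
    {f : Fin d → ℝ → ℂ}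
    (hD : ∀ j, ContinuousOn (D j) (Set.Ici s)) (hf : ∀ j, ContinuousOn (f j) (Set.Ici s))
    (hMP : ∀ τ, s ≤ τ → M τ * P τ = 1)
    (hP' : ∀ τ, s ≤ τ → ∀ i j,
      HasDerivWithinAt (fun τ => P τ i j) (P' τ i j) (Set.Ici s) τ)
    (hPA : ∀ τ, s ≤ τ → P τ * A τ * M τ + (-Complex.I) • P' τ * M τ =
      Matrix.diagonal (fun j => (D j τ : ℂ)) + R τ)
    (hK' : ∀ τ, s ≤ τ → ∀ i j,
      HasDerivWithinAt (fun τ => K τ i j) (K' τ i j) (Set.Ici s) τ)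
    (hK : ∀ τ, s ≤ τ → ∀ i j, R τ i j - K τ i j * D j τ =
      (if i = j then R τ i i else 0) - D i τ * K τ i j)
    (hKb : ∀ τ, s ≤ τ → ∀ i j, ‖K τ i j‖ ≤ CK) (hCK : d * CK ≤ 1 / 2)
    (hRb : ∀ τ, s ≤ τ → ∀ i j, ‖(Matrix.diagonal (fun j => f j τ) * K τ +
      (Matrix.diagonal (fun i => R τ i i - f i τ)) - K τ * R τ + Complex.I • K' τ) i j‖ ≤
      CR * r * ((1 + τ) ^ 2)⁻¹)
    (hMb : ∀ τ, s ≤ τ → ∀ i j, ‖M τ i j‖ ≤ CM) (hPb : ∀ i j, ‖P s i j‖ ≤ CP)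
    (hlow : ∀ j, ∀ s' t, s ≤ s' → s' ≤ t →
      κ * Real.log ((1 + t) / (1 + s')) + c ≤ (∫ τ in s'..t, f j τ).im)
    (hsmall : Real.exp (-c) * (2 * d * CR * r) * (1 + s)⁻¹ ≤ 1 / 2)
    (hE0 : E s = 1)
    (hE : ∀ τ, s ≤ τ → ∀ i j,
      HasDerivWithinAt (fun τ => E τ i j) (Complex.I * (A τ * E τ) i j) (Set.Ici s) τ)
    {t : ℝ} (hst : s ≤ t) (i q : Fin d) :
    ‖E t i q‖ ≤ 8 * d * CM * CP * Real.exp (-c) * ((1 + t) / (1 + s)) ^ (-κ) := by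
  set V : ℝ → Matrix (Fin d) (Fin d) ℂ := fun τ => P τ * E τ with hV
  set W : ℝ → Matrix (Fin d) (Fin d) ℂ := fun τ => (1 - K τ) * V τ with hW
  set Q : ℝ → Matrix (Fin d) (Fin d) ℂ := fun τ => Matrix.diagonal (fun j => f j τ) * K τ +
      (Matrix.diagonal (fun i => R τ i i - f i τ)) - K τ * R τ + Complex.I • K' τ with hQ
  have hEV : ∀ τ, s ≤ τ → E τ = M τ * V τ := fun τ hτ => by
    simp only [hV]; rw [← mul_assoc, hMP τ hτ, one_mul]
  have hV' : ∀ τ, s ≤ τ → ∀ i j, HasDerivWithinAt (fun τ => V τ i j)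
      ((Complex.I • ((Matrix.diagonal (fun j => (D j τ : ℂ)) + R τ) * V τ)) i j)
      (Set.Ici s) τ := by
    intro τ hτ i j
    have h := hasDerivWithinAt_matrix_mul (hP' τ hτ) (C := E)
      (C' := Complex.I • (A τ * E τ)) (fun i j => hE τ hτ i j) i j
    exact h.congr_deriv
      (congrFun (congrFun (first_step_identity (hEV τ hτ) (hPA τ hτ)) i) j)
  have hW' : ∀ τ, s ≤ τ → ∀ i j, HasDerivWithinAt (fun τ => W τ i j)
      ((Complex.I • ((Matrix.diagonal (fun j => (D j τ : ℂ)) +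
        Matrix.diagonal (fun j => f j τ)) * W τ + Q τ * V τ)) i j) (Set.Ici s) τ := by
    intro τ hτ i j
    have h := hasDerivWithinAt_matrix_mul (B := fun τ => 1 - K τ) (B' := -K' τ)
      (fun i j => (hK' τ hτ i j).const_sub ((1 : Matrix (Fin d) (Fin d) ℂ) i j)) (hV' τ hτ) i j
    exact h.congr_deriv (congrFun (congrFun (conjugation_identity (second_step_identity
      (fun j => (D j τ : ℂ)) (fun j => f j τ) (R τ) (K τ) (K' τ) (hK τ hτ))) i) j)
  -- From `V = W + KV` with `K` of norm at most `1/2`, the last term is absorbed column by column.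
  have hVW : ∀ τ, s ≤ τ → ∀ q, ‖fun j => V τ j q‖ ≤ 2 * ‖fun j => W τ j q‖ := by
    intro τ hτ q
    have h1 : ‖fun j => V τ j q‖ ≤ ‖fun j => W τ j q‖ + 1 / 2 * ‖fun j => V τ j q‖ := by
      refine (pi_norm_le_iff_of_nonneg (by positivity)).2 fun j => ?_
      have h2 : V τ j q = W τ j q + (K τ * V τ) j q := by
        simp only [hW]; rw [sub_mul, one_mul, Matrix.sub_apply]; ring
      rw [h2]
      refine (norm_add_le _ _).trans (add_le_add (norm_le_pi_norm (fun j => W τ j q) j) ?_)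
      exact (norm_mul_apply_le (hKb τ hτ) j q).trans
        (mul_le_mul_of_nonneg_right hCK (norm_nonneg _))
    linarith
  have hWs : ‖fun j => W s j q‖ ≤ 2 * CP := by
    have hCP : 0 ≤ CP := (norm_nonneg _).trans (hPb q q)
    have hVs : V s = P s := by simp only [hV]; rw [hE0, mul_one]
    have h0 : ‖fun j => V s j q‖ ≤ CP :=
      (pi_norm_le_iff_of_nonneg hCP).2 fun j => by rw [hVs]; exact hPb j q
    refine (pi_norm_le_iff_of_nonneg (by positivity)).2 fun j => ?_
    have h2 : W s j q = V s j q - (K s * V s) j q := by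
      simp only [hW]; rw [sub_mul, one_mul, Matrix.sub_apply]
    rw [h2]
    have h3 := (norm_mul_apply_le (V := V s) (hKb s le_rfl) j q).trans
      (mul_le_mul_of_nonneg_right hCK (norm_nonneg _))
    have h4 := norm_le_pi_norm (fun j => V s j q) j
    refine (norm_sub_le _ _).trans ?_
    linarith
  have hfin := norm_le_of_diagonal_dominated_system (s := s) (κ := κ) (c := c)
    (b := 2 * d * CR * r) hs (by positivity) (w := fun τ j => W τ j q)
    (ρ := fun τ j => (Q τ * V τ) j q) (D := D) (f := f) hD hf
    (fun j τ hτ => (hW' τ hτ j q).congr_deriv (by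
      rw [Matrix.smul_apply, smul_eq_mul, Matrix.add_apply, add_mul (Matrix.diagonal _),
        Matrix.add_apply, Matrix.diagonal_mul, Matrix.diagonal_mul, add_mul (D j τ : ℂ)]))
    hlow (fun j τ hτ => by
      refine (norm_mul_apply_le (hRb τ hτ) j q).trans ?_
      have h1 : 0 < 1 + τ := by linarith
      calc _ ≤ d * (CR * r * ((1 + τ) ^ 2)⁻¹) * (2 * ‖fun j => W τ j q‖) := by
            gcongr
            exact hVW τ hτ q
        _ = _ := by ring) hsmall hst
  rw [hEV t hst]
  have hCM : 0 ≤ CM := (norm_nonneg _).trans (hMb t hst i i)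
  have hx : 0 ≤ ((1 + t) / (1 + s)) ^ (-κ) :=
    Real.rpow_nonneg (div_nonneg (by linarith) (by linarith)) _
  -- The constant `8` collects three factors `2`: from `V` to `W`, from the system estimate, and
  -- from `W s` to `P s`.
  calc ‖(M t * V t) i q‖ ≤ d * CM * ‖fun j => V t j q‖ := norm_mul_apply_le (hMb t hst) i q
    _ ≤ d * CM * (2 * (2 * Real.exp (-c) * ((1 + t) / (1 + s)) ^ (-κ) * (2 * CP))) := by
        gcongr
        refine (hVW t hst q).trans ?_
        gcongr
        refine hfin.trans ?_
        gcongr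
    _ = _ := by ring

/-! ### Matrix symbols, the zone boundary and existence of solutions -/

theorem TimeSymbol.const (c : ℂ) : TimeSymbol N k 0 0 (fun _ : Phase n => c) := by
  have hb : BddOn N 0 0 (fun _ : Phase n => c) :=
    ⟨‖c‖, norm_nonneg _, fun z _ => by rw [weight_zero, mul_one]⟩
  cases k with
  | zero => exact ⟨hb, fun z _ => continuousWithinAt_const⟩
  | succ k => exact ⟨hb, _, fun z _ => hasDerivWithinAt_const _ _ _, TimeSymbol.zero⟩

theorem TimeSymbol.const_mul (hN : 0 < N) (c : ℂ) {a : Phase n → ℂ}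
    (h : TimeSymbol N k m₁ m₂ a) : TimeSymbol N k m₁ m₂ (fun z => c * a z) :=
  ((TimeSymbol.const c).mul hN h).congr (zero_add _) (zero_add _)

/-- The strict margin `N < N'` makes the two functions agree at nearby times `t ≥ 0` too, so they
share time derivatives. -/
theorem TimeSymbol.congr_on {a b : Phase n → ℂ} (h : TimeSymbol N' k m₁ m₂ a) (hNN : N < N')
    (hab : ∀ z ∈ Zhyp n N, a z = b z) : TimeSymbol N' k m₁ m₂ b := by
  have hbd : BddOn N' m₁ m₂ a → BddOn N' m₁ m₂ b := fun ⟨C, hC, h⟩ =>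
    ⟨C, hC, fun z hz => hab z (Zhyp_anti hNN.le hz) ▸ h z hz⟩
  have hev : ∀ z ∈ Zhyp n N',
      (fun τ => b (τ, z.2)) =ᶠ[nhdsWithin z.1 (Set.Ici 0)] fun τ => a (τ, z.2) := by
    intro z hz
    have hc : Continuous fun τ : ℝ => (1 + τ) * ‖z.2‖ := by fun_prop
    filter_upwards [self_mem_nhdsWithin, nhdsWithin_le_nhds
      (hc.continuousAt.eventually (lt_mem_nhds (hNN.trans_le hz.2)))] with τ h0 h1
    exact (hab (τ, z.2) ⟨h0, h1.le⟩).symm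
  have hat : ∀ z ∈ Zhyp n N', b z = a z := fun z hz => (hab z (Zhyp_anti hNN.le hz)).symm
  cases k with
  | zero =>
    exact ⟨hbd h.1, fun z hz => (h.2 z hz).congr_of_eventuallyEq (hev z hz) (hat z hz)⟩
  | succ k =>
    obtain ⟨h1, a', ha', hs⟩ := h
    exact ⟨hbd h1, a',
      fun z hz => (ha' z hz).congr_of_eventuallyEq (hev z hz) (hat z hz), hs⟩

/-- A matrix of functions in the class `TimeSymbol`. -/
def MatTimeSymbol (N : ℝ) (k : ℕ) (m₁ m₂ : ℝ) (B : Phase n → Matrix (Fin d) (Fin d) ℂ) : Prop :=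
  ∀ i j, TimeSymbol N k m₁ m₂ (fun z => B z i j)

variable {B B' : Phase n → Matrix (Fin d) (Fin d) ℂ}

theorem MatTimeSymbol.mul (hN : 0 < N) (h : MatTimeSymbol N k m₁ m₂ B)
    (h' : MatTimeSymbol N k m₁' m₂' B') :
    MatTimeSymbol N k (m₁ + m₁') (m₂ + m₂') (fun z => B z * B' z) := fun i j => by
  simp only [Matrix.mul_apply]
  exact TimeSymbol.sum _ fun l _ => (h i l).mul hN (h' l j)

theorem MatTimeSymbol.exists_bound (h : MatTimeSymbol N k m₁ m₂ B) (hN : 0 < N) :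
    ∃ C : ℝ, 0 ≤ C ∧ ∀ z ∈ Zhyp n N, ∀ i j, ‖B z i j‖ ≤ C * weight m₁ m₂ z := by
  choose C hC0 hC using fun i j => (h i j).bddOn
  refine ⟨∑ i, ∑ j, C i j, Finset.sum_nonneg fun i _ => Finset.sum_nonneg fun j _ => hC0 i j,
    fun z hz i j => (hC i j z hz).trans ?_⟩
  refine mul_le_mul_of_nonneg_right ?_ (weight_pos hN hz).le
  exact (Finset.single_le_sum (f := fun j => C i j) (fun j _ => hC0 i j)
    (Finset.mem_univ j)).trans (Finset.single_le_sum (f := fun i => ∑ j, C i j)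
      (fun i _ => Finset.sum_nonneg fun j _ => hC0 i j) (Finset.mem_univ i))

theorem IsMatSymbol.eventually_matTimeSymbol (h : IsMatSymbol m₁ m₂ B) (k : ℕ) :
    ∀ᶠ N in Filter.atTop, MatTimeSymbol N k m₁ m₂ B :=
  Filter.eventually_all.2 fun i => Filter.eventually_all.2 fun j =>
    (h i j).eventually_timeSymbol k

/-- The entrywise time derivative. -/
noncomputable def matTimeDeriv (B : Phase n → Matrix (Fin d) (Fin d) ℂ) (z : Phase n) :
    Matrix (Fin d) (Fin d) ℂ :=
  Matrix.of fun i j => timeDeriv 1 (fun w => B w i j) z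

theorem matDt_eq {z : Phase n} (hz0 : 0 ≤ z.1) (hz : N < (1 + z.1) * ‖z.2‖) :
    matDt N B z = (-Complex.I) • matTimeDeriv B z := by
  ext i j
  simp only [matDt, matTimeDeriv, Matrix.of_apply, Matrix.smul_apply, smul_eq_mul]
  rw [fderivWithin_Zhyp_eq_timeDeriv hz0 hz]

theorem IsMatSymbol.eventually_matTimeDeriv (h : IsMatSymbol m₁ m₂ B) (k : ℕ) :
    ∀ᶠ N in Filter.atTop, MatTimeSymbol N k m₁ (m₂ + 1) (matTimeDeriv B) ∧
      ∀ i j, HasTimeDeriv N (fun z => B z i j) (fun z => matTimeDeriv B z i j) := by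
  have h1 : ∀ i j, ∀ᶠ N in Filter.atTop, TimeSymbol N k m₁ (m₂ + 1)
      (fun z => matTimeDeriv B z i j) ∧
      HasTimeDeriv N (fun z => B z i j) (fun z => matTimeDeriv B z i j) := fun i j => by
    filter_upwards [(h i j).eventually_timeSymbol_timeDeriv k 0,
      (h i j).eventually_timeSymbol_timeDeriv k 1] with N h0 h1
    have h2 := h0.2
    rw [timeDeriv_zero] at h2
    exact ⟨h1.1.congr rfl (by simp), h2⟩
  filter_upwards [Filter.eventually_all.2 fun i => Filter.eventually_all.2 (h1 i)] with N hN
  exact ⟨fun i j => (hN i j).1, fun i j => (hN i j).2⟩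

theorem mem_Zhyp_of_tBdry_le {ξ : EuclideanSpace ℝ (Fin n)} (hξ : ξ ≠ 0) {t : ℝ}
    (ht : tBdry N ξ ≤ t) : (t, ξ) ∈ Zhyp n N := by
  refine ⟨(le_max_right _ _).trans ht, ?_⟩
  have h1 : N / ‖ξ‖ - 1 ≤ t := (le_max_left _ _).trans ht
  have h2 : 0 < ‖ξ‖ := norm_pos_iff.2 hξ
  have h3 : N / ‖ξ‖ ≤ 1 + t := by linarith
  exact (div_le_iff₀ h2).1 h3

theorem tBdry_nonneg (ξ : EuclideanSpace ℝ (Fin n)) : 0 ≤ tBdry N ξ := le_max_right _ _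

theorem tBdry_mono (h : N ≤ N') (ξ : EuclideanSpace ℝ (Fin n)) : tBdry N ξ ≤ tBdry N' ξ := by
  unfold tBdry; gcongr

theorem exists_isFundamentalSolution {A : Phase n → Matrix (Fin d) (Fin d) ℂ}
    {ξ : EuclideanSpace ℝ (Fin n)} {s : ℝ}
    (hA : ∀ i j, ContinuousOn (fun τ => A (τ, ξ) i j) (Set.Ici s)) :
    ∃ E : ℝ → Matrix (Fin d) (Fin d) ℂ, IsFundamentalSolution A ξ s E := by
  have hm : Continuous fun t : ℝ => max s t := by fun_prop
  -- The coefficient is frozen before `s`, where `A` need not be continuous.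
  let L : ℝ → (Fin d → Fin d → ℂ) →L[ℝ] (Fin d → Fin d → ℂ) := fun t =>
    LinearMap.toContinuousLinearMap
      { toFun := fun X i j => Complex.I * ∑ l, A (max s t, ξ) i l * X l j
        map_add' := fun X Y => by
          funext i j; simp only [Pi.add_apply, mul_add, Finset.sum_add_distrib]
        map_smul' := fun c X => by
          funext i j
          simp only [Pi.smul_apply, Complex.real_smul, RingHom.id_apply, Finset.mul_sum]
          exact Finset.sum_congr rfl fun l _ => by ring }
  have hL : Continuous L := by
    refine continuous_clm_apply.2 fun X => continuous_pi fun i => continuous_pi fun j => ?_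
    refine continuous_const.mul (continuous_finsetSum _ fun l _ => ?_)
    exact ((hA i l).comp_continuous hm fun t => Set.mem_Ici.2 (le_max_left _ _)).mul continuous_const
  obtain ⟨E, hE0, hE⟩ := exists_hasDerivWithinAt_linear L hL s
    (fun i j => (1 : Matrix (Fin d) (Fin d) ℂ) i j)
  refine ⟨fun t => Matrix.of (E t), by ext i j; simp [hE0], fun t ht i j => ?_⟩
  have h := hasDerivWithinAt_pi.1 (hasDerivWithinAt_pi.1 (hE t ht) i) j
  refine h.congr_deriv ?_
  simp [L, Matrix.mul_apply, max_eq_right ht]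

theorem TimeSymbol.continuousOn {a : Phase n → ℂ} (h : TimeSymbol N k m₁ m₂ a)
    {ξ : EuclideanSpace ℝ (Fin n)} (hξ : ξ ≠ 0) :
    ContinuousOn (fun τ => a (τ, ξ)) (Set.Ici (tBdry N ξ)) := fun _ hτ =>
  (h.continuousWithinAt (mem_Zhyp_of_tBdry_le hξ hτ)).mono
    (Set.Ici_subset_Ici.2 (tBdry_nonneg ξ))

theorem HasTimeDeriv.hasDerivWithinAt {a a' : Phase n → ℂ} (h : HasTimeDeriv N a a')
    {ξ : EuclideanSpace ℝ (Fin n)} (hξ : ξ ≠ 0) {τ : ℝ} (hτ : tBdry N ξ ≤ τ) :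
    HasDerivWithinAt (fun τ => a (τ, ξ)) (a' (τ, ξ)) (Set.Ici (tBdry N ξ)) τ :=
  (h _ (mem_Zhyp_of_tBdry_le hξ hτ)).mono (Set.Ici_subset_Ici.2 (tBdry_nonneg ξ))

end HypSys

/-! ### The estimate for the fundamental solution -/

open HypSys in
theorem mainTheorem6 (n d : ℕ) (A Ahom : HypSys.Phase n → Matrix (Fin d) (Fin d) ℂ)
    (κp κm : ℝ) (hA1 : HypSys.AssumptionA1 A Ahom)
    (hA2 : HypSys.AssumptionA2 A Ahom κp κm) :
    ∃ N₀ : ℝ, 0 < N₀ ∧ ∀ N : ℝ, N₀ ≤ N → ∃ C : ℝ, 0 < C ∧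
      ∀ ξ : EuclideanSpace ℝ (Fin n), ξ ≠ 0 →
        (∃ E : ℝ → Matrix (Fin d) (Fin d) ℂ,
          HypSys.IsFundamentalSolution A ξ (HypSys.tBdry N ξ) E) ∧
        ∀ E : ℝ → Matrix (Fin d) (Fin d) ℂ,
          HypSys.IsFundamentalSolution A ξ (HypSys.tBdry N ξ) E →
            ∀ t : ℝ, HypSys.tBdry N ξ ≤ t →
              HypSys.opNorm (E t) ≤ C * ((1 + t) / (1 + HypSys.tBdry N ξ)) ^ (-κp) := by
  obtain ⟨NA, M, F, c, _, hNA, hM, hF, hlow⟩ := hA2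
  obtain ⟨ev, δ, hδ, hev⟩ := hA1.eigenvalues
  -- A common zone for all symbols. The margin over `NA + 1` lets `D_t M⁻¹`, taken within the zone
  -- of `NA`, be replaced by the half-space derivative.
  obtain ⟨N₁, ⟨⟨⟨⟨hsA, hsR⟩, hsM⟩, hsP⟩, ⟨hsP', hP'⟩⟩, hsF, hN1⟩ :=
    (((((hA1.symbol_hom.eventually_matTimeSymbol 1).and
      (hA1.symbol_sub.eventually_matTimeSymbol 1)).and
      (hM.symbol.eventually_matTimeSymbol 1)).and
      (hM.symbol_inv.eventually_matTimeSymbol 1)).and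
      (hM.symbol_inv.eventually_matTimeDeriv 1)).and
      ((Filter.eventually_all.2 fun j => (hF j).eventually_timeSymbol 0).and
        (Filter.eventually_gt_atTop (NA + 1))) |>.exists
  have hN0 : 0 < N₁ := by linarith
  set P : Phase n → Matrix (Fin d) (Fin d) ℂ := fun z => (M z)⁻¹ with hP
  set P' : Phase n → Matrix (Fin d) (Fin d) ℂ := matTimeDeriv P with hPd
  set R : Phase n → Matrix (Fin d) (Fin d) ℂ := subprincipal NA A Ahom M with hR
  set D : Fin d → Phase n → ℂ := fun j z => (P z * Ahom z * M z) j j with hD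
  have hmem : ∀ z ∈ Zhyp n N₁, z ∈ Zhyp n NA := fun z hz => Zhyp_anti (by linarith) hz
  have hRP : ∀ z ∈ Zhyp n (NA + 1),
      P z * (A z - Ahom z) * M z + ((-Complex.I) • P' z) * M z = R z := fun z hz => by
    simp only [hR, subprincipal]
    rw [matDt_eq hz.1 ((lt_add_one NA).trans_le hz.2)]
  have hsRs : MatTimeSymbol N₁ 1 0 1 R := fun i j => by
    refine TimeSymbol.congr_on (a := fun z => (P z * (A z - Ahom z) * M z +
      ((-Complex.I) • P' z) * M z) i j) ?_ hN1 fun z hz => by rw [hRP z hz]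
    refine TimeSymbol.add ?_ ?_
    · exact (((hsP.mul hN0 hsR).mul hN0 hsM) i j).congr (by norm_num) (by norm_num)
    · have : MatTimeSymbol N₁ 1 0 (0 + 1) (fun z => (-Complex.I) • P' z) :=
        fun i j => (hsP' i j).const_mul hN0 _
      exact ((this.mul hN0 hsM) i j).congr (by norm_num) (by norm_num)
  have hsD : ∀ j, TimeSymbol N₁ 1 1 0 (D j) := fun j =>
    (((hsP.mul hN0 hsA).mul hN0 hsM) j j).congr (by norm_num) (by norm_num)
  have heig : ∀ z ∈ Zhyp n N₁, (∀ j, ((D j z).re : ℂ) = D j z) ∧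
      ∀ i j, i ≠ j → δ * ‖z.2‖ ≤ ‖D i z - D j z‖ := fun z hz => by
    have hz2 := norm_pos_of_mem_Zhyp hN0 hz
    obtain ⟨h1, h2⟩ := hev z.1 hz.1 z.2 (norm_pos_iff.1 hz2)
    exact eigenvalue_of_diagonalised (ev := fun j => ev j z) (mul_pos hδ hz2)
      (hM.invertible z (hmem z hz)) (hM.diagonal z (hmem z hz)) h1 h2
  set K : Phase n → Matrix (Fin d) (Fin d) ℂ := fun z => Matrix.of fun i j =>
    if i = j then 0 else R z i j * (D j z - D i z)⁻¹ with hK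
  have hsK : MatTimeSymbol N₁ 1 (-1) 1 K := fun i j => by
    by_cases hij : i = j
    · simpa [hK, hij] using TimeSymbol.zero
    · simp only [hK, Matrix.of_apply, if_neg hij]
      refine ((hsRs i j).mul hN0 (((hsD j).sub (hsD i)).inv hN0 hδ fun z hz => ?_)).congr
        (by norm_num) (by norm_num)
      simpa [weight] using (heig z hz).2 j i (Ne.symm hij)
  choose K' hK' hsK' using fun i j => (hsK i j).2
  -- Nothing is assumed on `F j` itself beyond the integral bounds; its size and continuity come
  -- from the diagonal of `R`, as `S{-1, 2} ⊆ S{0, 1}`.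
  have hsf : ∀ j, TimeSymbol N₁ 0 0 1 (F j) := fun j => by
    have h1 : TimeSymbol N₁ 0 0 1 (fun z => F j z - R z j j) :=
      TimeSymbol.embed hN0 ((hsF j).congr (by norm_num) (by norm_num))
    simpa using h1.add (hsRs j j).to_zero
  set Q : Phase n → Matrix (Fin d) (Fin d) ℂ := fun z => Matrix.diagonal (fun j => F j z) * K z +
    Matrix.diagonal (fun i => R z i i - F i z) - K z * R z +
    Complex.I • Matrix.of fun i j => K' i j z with hQ
  have hsQ : MatTimeSymbol N₁ 0 (-1) 2 Q := fun i j => by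
    simp only [hQ, Matrix.add_apply, Matrix.sub_apply, Matrix.diagonal_mul, Matrix.smul_apply,
      Matrix.of_apply, smul_eq_mul]
    refine ((TimeSymbol.add ?_ ?_).sub ?_).add ?_
    · exact ((hsf i).mul hN0 (hsK i j).to_zero).congr (by norm_num) (by norm_num)
    · by_cases hij : i = j
      · subst hij
        simpa using (hsF i).neg
      · simpa [hij] using TimeSymbol.zero
    · exact ((hsK.mul hN0 hsRs) i j).to_zero.congr (by norm_num) (by norm_num)
    · exact ((hsK' i j).const_mul hN0 _).congr rfl (by norm_num)
  obtain ⟨CK, hCK0, hCK⟩ := hsK.exists_bound hN0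
  obtain ⟨CQ, hCQ0, hCQ⟩ := hsQ.exists_bound hN0
  obtain ⟨CM, hCM0, hCM⟩ := hsM.exists_bound hN0
  obtain ⟨CP, hCP0, hCP⟩ := hsP.exists_bound hN0
  obtain ⟨Cd, hCd0, hCd⟩ := exists_opNorm_le d
  -- All constants refer to the fixed zone of `N₁`, so enlarging `N` is not circular. The two
  -- thresholds make `d CK / N` and `2 e^(-c) d CQ / N` at most `1/2`.
  refine ⟨max N₁ (max (2 * d * CK) (4 * Real.exp (-c) * d * CQ)),
    hN0.trans_le (le_max_left _ _), fun N hN => ?_⟩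
  have hN₁N : N₁ ≤ N := (le_max_left _ _).trans hN
  have hNK : 2 * d * CK ≤ N := ((le_max_left _ _).trans (le_max_right _ _)).trans hN
  have hNQ : 4 * Real.exp (-c) * d * CQ ≤ N :=
    ((le_max_right _ _).trans (le_max_right _ _)).trans hN
  have hNpos : 0 < N := hN0.trans_le hN₁N
  -- The added `1` only secures strict positivity, for instance when `d = 0`.
  refine ⟨Cd * (8 * d * CM * CP * Real.exp (-c)) + 1, by positivity, fun ξ hξ => ?_⟩
  have hz : ∀ τ, tBdry N ξ ≤ τ → (τ, ξ) ∈ Zhyp n N := fun τ hτ => mem_Zhyp_of_tBdry_le hξ hτ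
  have hz₁ : ∀ τ, tBdry N ξ ≤ τ → (τ, ξ) ∈ Zhyp n N₁ := fun τ hτ =>
    Zhyp_anti hN₁N (hz τ hτ)
  have hle : tBdry N₁ ξ ≤ tBdry N ξ := tBdry_mono hN₁N ξ
  have hs0 : 0 ≤ tBdry N ξ := tBdry_nonneg ξ
  have hξ0 : 0 < ‖ξ‖ := norm_pos_iff.2 hξ
  have hderiv : ∀ {a a' : Phase n → ℂ}, HasTimeDeriv N₁ a a' → ∀ τ, tBdry N ξ ≤ τ →
      HasDerivWithinAt (fun τ => a (τ, ξ)) (a' (τ, ξ)) (Set.Ici (tBdry N ξ)) τ :=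
    fun h τ hτ => (h.hasDerivWithinAt hξ (hle.trans hτ)).mono (Set.Ici_subset_Ici.2 hle)
  refine ⟨exists_isFundamentalSolution fun i j => ?_, fun E hE t ht => ?_⟩
  · have := ((hsA i j).continuousOn hξ).add ((hsR i j).continuousOn hξ)
    exact (this.mono (Set.Ici_subset_Ici.2 hle)).congr fun τ _ => by simp
  · have hx : 0 ≤ ((1 + t) / (1 + tBdry N ξ)) ^ (-κp) :=
      Real.rpow_nonneg (div_nonneg (by linarith) (by linarith)) _
    have hentry := fun i q => entry_bound_of_diagonalised_system (s := tBdry N ξ) (κ := κp)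
      (c := c) (r := ‖ξ‖⁻¹) (CK := CK * N⁻¹) (CR := CQ) (CM := CM) (CP := CP) hs0
      (by positivity) hCQ0 (A := fun τ => A (τ, ξ)) (M := fun τ => M (τ, ξ))
      (P := fun τ => P (τ, ξ)) (P' := fun τ => P' (τ, ξ)) (R := fun τ => R (τ, ξ))
      (K := fun τ => K (τ, ξ)) (K' := fun τ => Matrix.of fun i j => K' i j (τ, ξ)) (E := E)
      (D := fun j τ => (D j (τ, ξ)).re) (f := fun j τ => F j (τ, ξ))
      (fun j => Complex.continuous_re.comp_continuousOn
        (((hsD j).continuousOn hξ).mono (Set.Ici_subset_Ici.2 hle)))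
      (fun j => ((hsf j).continuousOn hξ).mono (Set.Ici_subset_Ici.2 hle))
      (fun τ hτ => Matrix.mul_nonsing_inv _ (hM.invertible _ (hmem _ (hz₁ τ hτ))))
      (fun τ hτ i j => hderiv (hP' i j) τ hτ)
      (fun τ hτ => by
        have h1 := hRP (τ, ξ) (Zhyp_anti hN1.le (hz₁ τ hτ))
        have h2 : Matrix.diagonal (fun j => (((D j (τ, ξ)).re : ℝ) : ℂ)) =
            P (τ, ξ) * Ahom (τ, ξ) * M (τ, ξ) := by
          simp only [(heig _ (hz₁ τ hτ)).1]
          exact (hM.diagonal _ (hmem _ (hz₁ τ hτ))).diagonal_diag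
        rw [h2, ← h1, mul_sub, sub_mul]
        abel)
      (fun τ hτ i j => hderiv (hK' i j) τ hτ)
      (fun τ hτ i j => by
        rw [(heig _ (hz₁ τ hτ)).1, (heig _ (hz₁ τ hτ)).1]
        by_cases hij : i = j
        · simp [hK, hij]
        · have hne : D j (τ, ξ) - D i (τ, ξ) ≠ 0 := norm_pos_iff.1
            ((mul_pos hδ hξ0).trans_le ((heig _ (hz₁ τ hτ)).2 j i (Ne.symm hij)))
          simp only [hK, Matrix.of_apply, if_neg hij]
          field_simp
          ring)
      (fun τ hτ i j => (hCK _ (hz₁ τ hτ) i j).trans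
        (mul_le_mul_of_nonneg_left (weight_neg_one_one_le hNpos (hz τ hτ)) hCK0))
      (by
        rw [← mul_assoc, ← div_eq_mul_inv, div_le_iff₀ hNpos]
        linarith)
      (fun τ hτ i j => by
        refine (hCQ _ (hz₁ τ hτ) i j).trans (le_of_eq ?_)
        have : 0 < 1 + τ := by linarith
        rw [weight, Real.rpow_neg_one, Real.rpow_neg this.le, Real.rpow_two, mul_assoc])
      (fun τ hτ i j => by
        have := hCM _ (hz₁ τ hτ) i j
        rwa [weight_zero, mul_one] at this)
      (fun i j => by
        have := hCP _ (hz₁ _ le_rfl) i j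
        rwa [weight_zero, mul_one] at this)
      (fun j s' t hs' hst => (hlow j ξ hξ s' t
        ((tBdry_mono (by linarith) ξ).trans hs') hst).1)
      (by
        have h1 : ‖ξ‖⁻¹ * (1 + tBdry N ξ)⁻¹ ≤ N⁻¹ := by
          rw [← mul_inv]
          refine inv_anti₀ hNpos ?_
          rw [mul_comm]
          exact (hz _ le_rfl).2
        calc _ = (2 * Real.exp (-c) * d * CQ) * (‖ξ‖⁻¹ * (1 + tBdry N ξ)⁻¹) := by ring
          _ ≤ (2 * Real.exp (-c) * d * CQ) * N⁻¹ := by gcongr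
          _ ≤ 1 / 2 := by
            rw [← div_eq_mul_inv, div_le_iff₀ hNpos]
            linarith)
      hE.initial hE.equation ht i q
    refine (hCd _ _ hentry).trans ?_
    rw [← mul_assoc]
    exact mul_le_mul_of_nonneg_right (le_add_of_nonneg_right zero_le_one) hx
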